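/- Let $\zeta=e^{2\pi i/3}$ and, for an expression $f(\zeta)$, write $\langle f(\zeta)\rangle=f(\zeta)-f(\zeta^{-1})$. Let $m,n\ge 0$ and let $s_1,\dots,s_m,t_1,\dots,t_n$ be nonnegative integers with $S=\sum_i s_i\ge T=\sum_j t_j$. Let $q_i,q'_j$ be rational numbers, let $(x_i,y_i)$ $(1\le i\le m)$ and $(z_j,w_j)$ $(1\le j\le n)$ be points of $\mathbb R^2$ with $(x_i,y_i)\ne(z_j,w_j)$ for all $i,j$, let $\alpha_i,\beta_i,\gamma_j,\delta_j$ be integers (only their residues mod 3 matter), and let $R>0$. Let $\lfloor\lfloor\widetilde M'\rfloor\rfloor$ be the $2S\times 2S$ matrix $$\lfloor\lfloor\widetilde M'\rfloor\rfloor=\frac1{2\pi i}\begin{bmatrix}\dot A_{11}&\cdots&\dot A_{1n}&\dot B_1\\ \vdots&&\vdots&\vdots\\ \dot A_{m1}&\cdots&\dot A_{mn}&\dot B_m\end{bmatrix},$$ where $\dot A_{ij}$ is the $2s_i\times 2t_j$ matrix made of the $2\times2$ blocks, in position $(k,l)$, $1\le k\le s_i$, $1\le l\le t_j$, $$\left[\left\langle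 \frac{\zeta^{e_{uv}+\alpha_i-\beta_i+\gamma_j-\delta_j}\binom{k+l-2}{l-1}(1-q_i\zeta)^{k-1}(1-q'_j\zeta)^{l-1}}{[z_j-x_i-\zeta(w_j-y_i)]^{k+l-1}R^{k+l-1}}\right\rangle\right]_{u,v=1,2},$$ and $\dot B_i$ is the $2s_i\times 2(S-T)$ matrix made of the $2\times2$ blocks, in position $(k,l)$, $1\le k\le s_i$, $1\le l\le S-T$, $$\left[\left\langle \zeta^{e_{uv}+\alpha_i-\beta_i}\binom{l-1}{k-1}(1-q_i\zeta)^{k-1}(x_i-\zeta y_i)^{l-k}R^{l-k}\right\rangle\right]_{u,v=1,2}$$ (read as $0$ if $l<k$), with $\begin{bmatrix}e_{11}&e_{12}\\e_{21}&e_{22}\end{bmatrix}=\begin{bmatrix}-1&-3\\1&-1\end{bmatrix}$ in both cases. Put $d(u,v)=u^2+uv+v^2$ (the squared Euclidean length in $60^\circ$ coordinates) and $$N=2\sum_{1\le i<j\le m}s_is_j+2\sum_{1\le i<j\le n}t_it_j-2\sum_{i=1}^m\sum_{j=1}^n s_it_j .$$ Then $$\begin{aligned}\det\lfloor\lfloor\widetilde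 M'\rfloor\rfloor={}&\prod_{i=1}^m(q_i^2+q_i+1)^{s_i(s_i-1)/2}\prod_{j=1}^n(q_j'^2+q_j'+1)^{t_j(t_j-1)/2}\left(\frac{3}{4\pi^2}\right)^{S}\\ &\times\prod_{1\le i<j\le m}d(x_i-x_j,y_i-y_j)^{s_is_j}\prod_{1\le i<j\le n}d(z_i-z_j,w_i-w_j)^{t_it_j}\prod_{i=1}^m\prod_{j=1}^n d(x_i-z_j,y_i-w_j)^{-s_it_j}\;R^N .\end{aligned}$$ In particular the determinant does not depend on the residues mod 3 of the $\alpha_i,\beta_i,\gamma_j,\delta_j$. -/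

import Mathlib

noncomputable section

/-- The primitive cube root of unity `ζ = e^{2πi/3}`. -/
def zetaThree : ℂ := Complex.exp (2 * Real.pi * Complex.I / 3)

/-- The bracket `⟨f(ζ)⟩ = f(ζ) - f(ζ⁻¹)`. -/
def zetaBracket (f : ℂ → ℂ) : ℂ := f zetaThree - f zetaThree⁻¹

/-- The square of the Euclidean length of a vector with coordinates `(u, v)` in a
`60°` oblique coordinate system. -/
def obliqueNormSq (u v : ℝ) : ℝ := u ^ 2 + u * v + v ^ 2

/-- The shifts of the exponent of `ζ` inside every `2 × 2` block. -/
def blockShift : Matrix (Fin 2) (Fin 2) ℤ := !![-1, -3; 1, -1]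

/-- The `2 × 2` block in position `(k + 1, l + 1)` of the `2s × 2t` matrix `Ȧ` attached to a
multihole at `(x, y)` and an oppositely oriented one at `(z, w)`; here `k` and `l` count from
zero, and `a, b, c, d` are the residues `α, β, γ, δ`. -/
def dotA (R : ℝ) (x y z w : ℝ) (a b c d : ℤ) (q q' : ℚ) (k l : ℕ) :
    Matrix (Fin 2) (Fin 2) ℂ :=
  Matrix.of fun u v => zetaBracket fun h =>
    h ^ (blockShift u v + a - b + c - d) * ((k + l).choose l : ℂ)
        * (1 - (q : ℂ) * h) ^ k * (1 - (q' : ℂ) * h) ^ l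
      / (((z : ℂ) - x - h * ((w : ℂ) - y)) ^ (k + l + 1) * (R : ℂ) ^ (k + l + 1))

/-- The `2 × 2` block in position `(k + 1, l + 1)` of the matrix `Ḃ` attached to a multihole at
`(x, y)`; `k` and `l` count from zero. For `l < k` the binomial coefficient vanishes, so only
nonnegative powers of `x - ζ y` and of `R` occur in the numerator. -/
def dotB (R : ℝ) (x y : ℝ) (a b : ℤ) (q : ℚ) (k l : ℕ) : Matrix (Fin 2) (Fin 2) ℂ :=
  Matrix.of fun u v => zetaBracket fun h =>
    h ^ (blockShift u v + a - b) * (l.choose k : ℂ) * (1 - (q : ℂ) * h) ^ k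
      / (((x : ℂ) - h * (y : ℂ)) ^ ((k : ℤ) - (l : ℤ)) * (R : ℂ) ^ ((k : ℤ) - (l : ℤ)))

variable {m n : ℕ}

/-- The block matrix of dominant terms, before numbering its rows and columns. A row is given by
a block-row `i`, a position `k` in it and a parity; a column either by a block-column `j`, a
position `l` in it and a parity (the `Ȧ` part), or by a position `l` in the last block-column and
a parity (the `Ḃ` part). -/
def dominantBlocks (s : Fin m → ℕ) (t : Fin n → ℕ) (R : ℝ)
    (x y : Fin m → ℝ) (z w : Fin n → ℝ)
    (α β : Fin m → ℤ) (γ δ : Fin n → ℤ) (q : Fin m → ℚ) (q' : Fin n → ℚ) :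
    Matrix ((Σ i, Fin (s i)) × Fin 2)
      (((Σ j, Fin (t j)) ⊕ Fin (∑ i, s i - ∑ j, t j)) × Fin 2) ℂ :=
  Matrix.of fun r c =>
    (1 / (2 * Real.pi * Complex.I)) *
      match c.1 with
      | Sum.inl jl =>
          dotA R (x r.1.1) (y r.1.1) (z jl.1) (w jl.1) (α r.1.1) (β r.1.1) (γ jl.1) (δ jl.1)
            (q r.1.1) (q' jl.1) r.1.2 jl.2 r.2 c.2
      | Sum.inr l => dotB R (x r.1.1) (y r.1.1) (α r.1.1) (β r.1.1) (q r.1.1) r.1.2 l r.2 c.2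

/-- The numbering of the rows from top to bottom. -/
def rowNumbering (s : Fin m → ℕ) :
    ((Σ i, Fin (s i)) × Fin 2) ≃ Fin ((∑ i, s i) * 2) :=
  (finSigmaFinEquiv.prodCongr (Equiv.refl _)).trans finProdFinEquiv

/-- The numbering of the columns from left to right: first the `Ȧ` blocks, then the `Ḃ` block. -/
def colNumbering (s : Fin m → ℕ) (t : Fin n → ℕ) (h : ∑ j, t j ≤ ∑ i, s i) :
    (((Σ j, Fin (t j)) ⊕ Fin (∑ i, s i - ∑ j, t j)) × Fin 2) ≃ Fin ((∑ i, s i) * 2) :=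
  ((((finSigmaFinEquiv.sumCongr (Equiv.refl _)).trans finSumFinEquiv).trans
    (finCongr (Nat.add_sub_of_le h))).prodCongr (Equiv.refl _)).trans finProdFinEquiv

/-- The `2S × 2S` matrix of dominant terms, `S = ∑ s i`. -/
def dominantMatrix (s : Fin m → ℕ) (t : Fin n → ℕ) (h : ∑ j, t j ≤ ∑ i, s i) (R : ℝ)
    (x y : Fin m → ℝ) (z w : Fin n → ℝ)
    (α β : Fin m → ℤ) (γ δ : Fin n → ℤ) (q : Fin m → ℚ) (q' : Fin n → ℚ) :
    Matrix (Fin ((∑ i, s i) * 2)) (Fin ((∑ i, s i) * 2)) ℂ :=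
  Matrix.reindex (rowNumbering s) (colNumbering s t h)
    (dominantBlocks s t R x y z w α β γ δ q q')

/-- The exponent `N` of `R`. -/
def scaleExponent (s : Fin m → ℕ) (t : Fin n → ℕ) : ℤ :=
  2 * ∑ i, ∑ j ∈ Finset.Ioi i, (s i : ℤ) * s j + 2 * ∑ i, ∑ j ∈ Finset.Ioi i, (t i : ℤ) * t j
    - 2 * ∑ i, ∑ j, (s i : ℤ) * t j

end

/-! Write `ζ` for `zetaThree`. Modulo 3 the shifts split as `e_uv = a_u + b_v` with `a = (-1, 1)`
and `b = (0, 1)`. A block `ζ^e D - ζ^(-e) D'` is therefore a constant matrix times `diag(D, D')`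
times a constant matrix. With `D'` the conjugate of `D`, the whole determinant is `(3 / 4π²)^S |det
D(ζ)|²` (`dominantMatrix_eq`, `det_dominantMatrix`).

The powers of `ζ` and of `1 - qζ` in `D(ζ)` are row and column factors. Powers of `ζ` have modulus
1, so the residues disappear, and `|1 - qζ|² = q² + q + 1`. What remains is a confluent
Cauchy–Vandermonde matrix with nodes `R(x - ζy)` and poles `R(z - ζw)`. Since `|u - ζv|² = u² + uv +
v²`, its determinant yields the distances.

That determinant comes from `det_confluentCauchyVandermonde_sq`. Multiplying by `P = ∏ (X -
z_j)^(t_j)` clears denominators and leaves Taylor coefficients of polynomials of degree `< S`, that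
is, a confluent Vandermonde matrix times a matrix of coefficients. The second determinant is found
by evaluating the numerators at the poles themselves. Only moduli matter in the end, so these
determinants are computed squared, which discards permutation signs. -/

open Polynomial

/-! ### Confluent Vandermonde determinants through the Newton basis. -/

noncomputable section

variable {R : Type*} [CommRing R]

/-- A square matrix that is lower triangular for some injective grading of its index set has the
product of its diagonal entries as determinant. -/
theorem det_eq_prod_diag_of_injective {ι α : Type*} [Fintype ι] [DecidableEq ι] [LinearOrder α]
    (M : Matrix ι ι R) (b : ι → α) (hb : Function.Injective b)
    (h : ∀ r c, b r < b c → M r c = 0) : M.det = ∏ r, M r r := by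
  classical
  let _ : LinearOrder ι := LinearOrder.lift' b hb
  have h2 := Matrix.det_of_isLowerTriangular M (fun r c hrc => h r c hrc)
  convert h2

/-- The Taylor coefficients of order `< s i` at `v i` of the polynomials `p c`. -/
def taylorMatrix {κ : Type*} {m : ℕ} (s : Fin m → ℕ) (v : Fin m → R) (p : κ → R[X]) :
    Matrix (Σ i, Fin (s i)) κ R :=
  Matrix.of fun r c => (taylor (v r.1) (p c)).coeff r.2

/-- The coefficients of degree `< N` of the polynomials `p c`. -/
def coeffMatrix {κ : Type*} (N : ℕ) (p : κ → R[X]) : Matrix (Fin N) κ R :=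
  Matrix.of fun a c => (p c).coeff a

/-- The confluent Vandermonde matrix with nodes `v i` of multiplicity `s i`. -/
def confluentVandermonde {m : ℕ} (s : Fin m → ℕ) (v : Fin m → R) :
    Matrix (Σ i, Fin (s i)) (Fin (∑ i, s i)) R :=
  taylorMatrix s v fun a => X ^ (a : ℕ)

/-- Taylor coefficients are linear in the coefficients of a polynomial. Hence a determinant of
Taylor coefficients splits into a factor depending on the nodes and a factor depending on the
polynomials. -/
theorem confluentVandermonde_mul_coeffMatrix {κ : Type*} {m : ℕ} (s : Fin m → ℕ) (v : Fin m → R)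
    (p : κ → R[X]) (hp : ∀ c, (p c).degree < (∑ i, s i : ℕ)) :
    confluentVandermonde s v * coeffMatrix (∑ i, s i) p = taylorMatrix s v p := by
  ext r c
  have h : p c = ∑ a : Fin (∑ i, s i), C ((p c).coeff a) * X ^ (a : ℕ) := by
    rw [Fin.sum_univ_eq_sum_range (fun a => C ((p c).coeff a) * X ^ a)]
    ext a
    simp only [finsetSum_coeff, coeff_C_mul_X_pow]
    rw [Finset.sum_ite_eq]
    split_ifs with ha
    · rfl
    · exact coeff_eq_zero_of_degree_lt
        ((hp c).trans_le (by exact_mod_cast not_lt.1 fun h => ha (Finset.mem_range.2 h)))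
  simp only [Matrix.mul_apply, confluentVandermonde, coeffMatrix, taylorMatrix, Matrix.of_apply]
  conv_rhs => rw [h]
  simp only [map_sum, finsetSum_coeff, taylor_mul, taylor_C, coeff_C_mul]
  exact Finset.sum_congr rfl fun a _ => mul_comm _ _

theorem coeff_taylor_X_sub_C_pow_mul (x : R) (q : R[X]) (r k : ℕ) :
    (taylor x ((X - C x) ^ r * q)).coeff k = if r ≤ k then (taylor x q).coeff (k - r) else 0 := by
  have : taylor x ((X - C x) ^ r * q) = X ^ r * taylor x q := by
    simp [taylor_mul, taylor_pow]
  rw [this, coeff_X_pow_mul']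

theorem coeff_taylor_of_dvd {x : R} {p : R[X]} {r k : ℕ} (hk : k < r) (h : (X - C x) ^ r ∣ p) :
    (taylor x p).coeff k = 0 := by
  obtain ⟨q, rfl⟩ := h
  rw [coeff_taylor_X_sub_C_pow_mul, if_neg (by omega)]

theorem prod_fin_castLE {M : Type*} [CommMonoid M] {m : ℕ} (i : Fin m) (f : Fin m → M) :
    ∏ j : Fin i.1, f (Fin.castLE i.2.le j) = ∏ j ∈ Finset.Iio i, f j := by
  refine Finset.prod_bij (fun j _ => Fin.castLE i.2.le j) ?_ ?_ ?_ ?_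
  · intro j _; rw [Finset.mem_Iio, Fin.lt_def]; exact j.2
  · intro a _ b _ h; simpa using h
  · intro j hj; exact ⟨⟨j, Fin.lt_def.1 (Finset.mem_Iio.1 hj)⟩, by simp, rfl⟩
  · intro j _; rfl

/-- The Newton basis attached to nodes with multiplicities. -/
def newtonPolynomial {m : ℕ} (s : Fin m → ℕ) (v : Fin m → R) (c : Σ i, Fin (s i)) : R[X] :=
  (X - C (v c.1)) ^ (c.2 : ℕ) * ∏ i ∈ Finset.Iio c.1, (X - C (v i)) ^ s i

theorem newtonPolynomial_monic {m : ℕ} (s : Fin m → ℕ) (v : Fin m → R) (c : Σ i, Fin (s i)) :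
    (newtonPolynomial s v c).Monic :=
  ((monic_X_sub_C _).pow _).mul (monic_prod_of_monic _ _ fun _ _ => (monic_X_sub_C _).pow _)

theorem natDegree_newtonPolynomial [Nontrivial R] {m : ℕ} (s : Fin m → ℕ) (v : Fin m → R)
    (c : Σ i, Fin (s i)) : (newtonPolynomial s v c).natDegree = finSigmaFinEquiv c := by
  rw [finSigmaFinEquiv_apply, newtonPolynomial, ((monic_X_sub_C _).pow _).natDegree_mul
    (monic_prod_of_monic _ _ fun _ _ => (monic_X_sub_C _).pow _),
    natDegree_prod_of_monic _ _ fun _ _ => (monic_X_sub_C _).pow _]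
  simp only [(monic_X_sub_C _).natDegree_pow, natDegree_X_sub_C, mul_one]
  -- Taking values in `Multiplicative ℕ` turns the product identity into the one for sums of
  -- multiplicities.
  have := prod_fin_castLE (M := Multiplicative ℕ) c.1 s
  rw [add_comm]
  congr 1
  exact this.symm

/-- The Newton polynomial of `(j, l)` vanishes to order `s i` at each earlier node and to order `l`
at `v j`, so the matrix is lower triangular in the lexicographic order. -/
theorem det_taylorMatrix_newtonPolynomial {m : ℕ} (s : Fin m → ℕ) (v : Fin m → R) :
    (taylorMatrix s v (newtonPolynomial s v)).det =
      ∏ i, ∏ j ∈ Finset.Iio i, (v i - v j) ^ (s j * s i) := by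
  rw [det_eq_prod_diag_of_injective _
    (fun r : Σ i, Fin (s i) => toLex (r.1, (r.2 : ℕ)))]
  · rw [Fintype.prod_sigma]
    refine Finset.prod_congr rfl fun i _ => ?_
    simp only [taylorMatrix, newtonPolynomial, Matrix.of_apply, coeff_taylor_X_sub_C_pow_mul,
      le_refl, if_true, Nat.sub_self, taylor_coeff_zero, eval_prod, eval_pow, eval_sub, eval_X,
      eval_C, Finset.prod_const, Finset.card_univ, Fintype.card_fin, pow_mul, Finset.prod_pow]
  · rintro ⟨i, k⟩ ⟨j, l⟩ h
    simp only [EmbeddingLike.apply_eq_iff_eq, Prod.mk.injEq] at h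
    obtain ⟨rfl, h⟩ := h
    simp [Fin.ext h]
  · rintro ⟨i, k⟩ ⟨j, l⟩ h
    rw [Prod.Lex.toLex_lt_toLex] at h
    simp only [taylorMatrix, Matrix.of_apply]
    rcases h with h | ⟨h, h'⟩
    · exact coeff_taylor_of_dvd k.2 (Dvd.dvd.mul_left
        (Finset.dvd_prod_of_mem (fun i => (X - C (v i)) ^ s i) (Finset.mem_Iio.2 h)) _)
    · simp only at h h'
      subst h
      exact coeff_taylor_of_dvd h' (Dvd.intro _ rfl)

/-- Newton polynomials are monic with degree equal to their position, so passing from monomials to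
them is unitriangular and preserves the determinant. -/
theorem det_confluentVandermonde {m : ℕ} (s : Fin m → ℕ) (v : Fin m → R) :
    ((confluentVandermonde s v).submatrix id finSigmaFinEquiv).det =
      ∏ i, ∏ j ∈ Finset.Iio i, (v i - v j) ^ (s j * s i) := by
  nontriviality R
  have hdeg : ∀ c, (newtonPolynomial s v c).degree < (∑ i, s i : ℕ) := fun c => by
    rw [degree_eq_natDegree (newtonPolynomial_monic s v c).ne_zero, natDegree_newtonPolynomial]
    exact_mod_cast (finSigmaFinEquiv c).2
  have h1 : ((coeffMatrix (∑ i, s i) (newtonPolynomial s v)).submatrix finSigmaFinEquiv id).det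
      = 1 := by
    rw [← Matrix.det_transpose, det_eq_prod_diag_of_injective _ finSigmaFinEquiv
      finSigmaFinEquiv.injective]
    · refine Finset.prod_eq_one fun c _ => ?_
      simp only [coeffMatrix, Matrix.submatrix_apply, Matrix.of_apply, Matrix.transpose_apply, id]
      rw [← natDegree_newtonPolynomial s v c]
      exact newtonPolynomial_monic s v c
    · intro r c h
      simp only [coeffMatrix, Matrix.submatrix_apply, Matrix.of_apply, Matrix.transpose_apply, id]
      exact coeff_eq_zero_of_natDegree_lt (by rw [natDegree_newtonPolynomial]; exact h)
  rw [← det_taylorMatrix_newtonPolynomial, ← confluentVandermonde_mul_coeffMatrix _ _ _ hdeg,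
    ← Matrix.submatrix_id_id (_ * _), ← Matrix.submatrix_mul_equiv _ _ id finSigmaFinEquiv id,
    Matrix.det_mul, h1, mul_one]

/-- Two numberings differ by a permutation, whose sign squares to 1. -/
theorem det_submatrix_equiv_sq {ι κ : Type*} [Fintype ι] [DecidableEq ι] [Fintype κ]
    [DecidableEq κ] (M : Matrix ι κ R) (e f : ι ≃ κ) :
    (M.submatrix id e).det ^ 2 = (M.submatrix id f).det ^ 2 := by
  have h : M.submatrix id e = (M.submatrix id f).submatrix id (e.trans f.symm) := by
    ext; simp
  rw [h, Matrix.det_permute', mul_pow, ← Int.cast_pow, ← Units.val_pow_eq_pow_val,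
    Int.units_sq]
  simp

end

/-! ### Numerators over the common denominator and their coefficient determinants. -/

noncomputable section

theorem prod_erase_eq_prod_Iio_mul {M : Type*} [CommMonoid M] {m : ℕ} (f : Fin m → Fin m → M) :
    ∏ i, ∏ j ∈ Finset.univ.erase i, f i j =
      (∏ i, ∏ j ∈ Finset.Iio i, f i j) * ∏ i, ∏ j ∈ Finset.Iio i, f j i := by
  have h : ∏ i, ∏ j ∈ Finset.Iio i, f j i = ∏ i, ∏ j ∈ Finset.Ioi i, f i j :=
    Finset.prod_comm' fun _ _ => by simp
  rw [h, ← Finset.prod_mul_distrib]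
  refine Finset.prod_congr rfl fun i _ => ?_
  rw [← Finset.prod_union]
  · refine Finset.prod_congr ?_ fun _ _ => rfl
    ext j
    simp [lt_or_lt_iff_ne]
  · rw [Finset.disjoint_left]
    intro j hj hj'
    exact lt_asymm (Finset.mem_Iio.1 hj) (Finset.mem_Ioi.1 hj')

variable {K : Type*} [Field K] {m n : ℕ}

/-- The common denominator `∏ (X - z j) ^ t j`. -/
def nodePolynomial (t : Fin n → ℕ) (z : Fin n → K) : K[X] := ∏ j, (X - C (z j)) ^ t j

/-- The quotient of `nodePolynomial t z` by `(z j - X) ^ (l + 1)`, for `c = (j, l)`. -/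
def nodeQuotient (t : Fin n → ℕ) (z : Fin n → K) (c : Σ j, Fin (t j)) : K[X] :=
  C ((-1) ^ (c.2.1 + 1)) * ((X - C (z c.1)) ^ (c.2.rev : ℕ) *
    ∏ j ∈ Finset.univ.erase c.1, (X - C (z j)) ^ t j)

theorem nodeQuotient_mul (t : Fin n → ℕ) (z : Fin n → K) (c : Σ j, Fin (t j)) :
    nodeQuotient t z c * (C (z c.1) - X) ^ (c.2.1 + 1) = nodePolynomial t z := by
  have h : (C (z c.1) - X : K[X]) = C (-1) * (X - C (z c.1)) := by simp
  have h2 : (X - C (z c.1)) ^ t c.1 = (X - C (z c.1)) ^ (c.2.rev : ℕ) *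
      (X - C (z c.1)) ^ (c.2.1 + 1) := by
    rw [← pow_add, Fin.val_rev]
    congr 1
    have := c.2.2
    omega
  have h3 : C ((-1 : K) ^ (c.2.1 + 1)) * C ((-1 : K) ^ (c.2.1 + 1)) = 1 := by
    rw [← C_mul, ← mul_pow]; simp
  rw [nodePolynomial, ← Finset.mul_prod_erase _ _ (Finset.mem_univ c.1), h2, nodeQuotient, h,
    mul_pow, ← C_pow]
  linear_combination ((X - C (z c.1)) ^ (c.2.rev : ℕ) *
      (X - C (z c.1)) ^ (c.2.1 + 1) * ∏ j ∈ Finset.univ.erase c.1, (X - C (z j)) ^ t j) * h3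

theorem nodePolynomial_monic (t : Fin n → ℕ) (z : Fin n → K) : (nodePolynomial t z).Monic :=
  monic_prod_of_monic _ _ fun _ _ => (monic_X_sub_C _).pow _

theorem natDegree_nodePolynomial (t : Fin n → ℕ) (z : Fin n → K) :
    (nodePolynomial t z).natDegree = ∑ j, t j := by
  rw [nodePolynomial, natDegree_prod_of_monic _ _ fun _ _ => (monic_X_sub_C _).pow _]
  simp

theorem natDegree_nodeQuotient_lt (t : Fin n → ℕ) (z : Fin n → K) (c : Σ j, Fin (t j)) :
    (nodeQuotient t z c).natDegree < ∑ j, t j := by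
  have h := congrArg natDegree (nodeQuotient_mul t z c)
  have hc : (C (z c.1) - X : K[X]).natDegree = 1 := by
    rw [← natDegree_neg, neg_sub, natDegree_X_sub_C]
  have h0 : nodeQuotient t z c ≠ 0 := fun h0 =>
    (nodePolynomial_monic t z).ne_zero (by rw [← nodeQuotient_mul t z c, h0, zero_mul])
  have h1 : (C (z c.1) - X : K[X]) ≠ 0 := fun h0 => by simp [h0] at hc
  rw [natDegree_mul h0 (pow_ne_zero _ h1), natDegree_pow, hc, natDegree_nodePolynomial] at h
  omega

theorem degree_nodeQuotient_lt (t : Fin n → ℕ) (z : Fin n → K) (c : Σ j, Fin (t j)) :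
    (nodeQuotient t z c).degree < (∑ j, t j : ℕ) :=
  degree_le_natDegree.trans_lt (by exact_mod_cast natDegree_nodeQuotient_lt t z c)

/-- The Vandermonde product with multiplicities. -/
def vandermondeProd (s : Fin m → ℕ) (v : Fin m → K) : K :=
  ∏ i, ∏ j ∈ Finset.Iio i, (v i - v j) ^ (s j * s i)

/-- The quotient for `(j, l)` vanishes to full order at every other node and to order `t j - 1 - l`
at `z j`. Reversing `l` within each block makes the matrix triangular with diagonal entries `±∏_{j ≠
i} (z i - z j)^(t j)`. Each pair of nodes enters twice, which gives the Vandermonde product squared,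
up to sign. -/
theorem det_taylorMatrix_nodeQuotient_sq (t : Fin n → ℕ) (z : Fin n → K) :
    (taylorMatrix t z (nodeQuotient t z)).det ^ 2 = (vandermondeProd t z ^ 2) ^ 2 := by
  have h := det_submatrix_equiv_sq (taylorMatrix t z (nodeQuotient t z)) (Equiv.refl _)
    (Equiv.sigmaCongrRight fun _ => Fin.revPerm)
  rw [Equiv.coe_refl, Matrix.submatrix_id_id] at h
  rw [h, det_eq_prod_diag_of_injective _
    (fun r : Σ i, Fin (t i) => toLex (r.1, (r.2 : ℕ)))]
  · rw [← Finset.prod_pow, Fintype.prod_sigma]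
    have hV : (∏ i, ∏ j ∈ Finset.Iio i, (z j - z i) ^ (t i * t j)) ^ 2 =
        vandermondeProd t z ^ 2 := by
      simp only [vandermondeProd, ← Finset.prod_pow]
      refine Finset.prod_congr rfl fun i _ => Finset.prod_congr rfl fun j _ => ?_
      rw [pow_right_comm, pow_right_comm (z i - z j), mul_comm (t i)]
      congr 1
      ring
    have hE : (∏ i, ∏ j ∈ Finset.univ.erase i, (z i - z j) ^ (t j * t i)) ^ 2 =
        (vandermondeProd t z ^ 2) ^ 2 := by
      rw [prod_erase_eq_prod_Iio_mul, mul_pow, hV, ← vandermondeProd]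
      ring
    rw [← hE, ← Finset.prod_pow]
    refine Finset.prod_congr rfl fun i _ => ?_
    have hd : ∀ k : Fin (t i), ((taylorMatrix t z (nodeQuotient t z)).submatrix id
        (Equiv.sigmaCongrRight fun _ => Fin.revPerm)) ⟨i, k⟩ ⟨i, k⟩ ^ 2 =
        (∏ j ∈ Finset.univ.erase i, (z i - z j) ^ t j) ^ 2 := fun k => by
      simp only [taylorMatrix, nodeQuotient, Matrix.submatrix_apply, Matrix.of_apply, id,
        Equiv.sigmaCongrRight_apply, Fin.revPerm_apply, taylor_mul, taylor_C, coeff_C_mul]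
      rw [← taylor_mul, coeff_taylor_X_sub_C_pow_mul, Fin.rev_rev, if_pos le_rfl, Nat.sub_self,
        taylor_coeff_zero, eval_prod, mul_pow, ← pow_mul, mul_comm _ 2, pow_mul, neg_one_sq,
        one_pow, one_mul]
      simp
    rw [Finset.prod_congr rfl fun k _ => hd k, Finset.prod_const, Finset.card_univ,
      Fintype.card_fin, pow_right_comm, ← Finset.prod_pow]
    simp only [pow_mul]
  · rintro ⟨i, k⟩ ⟨j, l⟩ h
    simp only [EmbeddingLike.apply_eq_iff_eq, Prod.mk.injEq] at h
    obtain ⟨rfl, h⟩ := h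
    simp [Fin.ext h]
  · rintro ⟨i, k⟩ ⟨j, l⟩ h
    rw [Prod.Lex.toLex_lt_toLex] at h
    simp only [taylorMatrix, Matrix.of_apply, Matrix.submatrix_apply, id,
      Equiv.sigmaCongrRight_apply, Fin.revPerm_apply]
    simp only at h
    by_cases hij : i = j
    · subst hij
      refine coeff_taylor_of_dvd (r := l) (by simpa using h) (Dvd.dvd.mul_left ?_ _)
      simp
    · exact coeff_taylor_of_dvd k.2 (Dvd.dvd.mul_left (Dvd.dvd.mul_left
        (Finset.dvd_prod_of_mem (fun i => (X - C (z i)) ^ t i) (by simpa using hij)) _) _)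

/-- The Taylor matrix at the nodes `z` is the confluent Vandermonde matrix times this one, so one
Vandermonde factor cancels from the previous determinant. -/
theorem det_coeffMatrix_nodeQuotient_sq (t : Fin n → ℕ) (z : Fin n → K) :
    ((coeffMatrix (∑ j, t j) (nodeQuotient t z)).submatrix finSigmaFinEquiv id).det ^ 2 =
      vandermondeProd t z ^ 2 := by
  have h := det_taylorMatrix_nodeQuotient_sq t z
  rw [← confluentVandermonde_mul_coeffMatrix _ _ _ (degree_nodeQuotient_lt t z),
    ← Matrix.submatrix_id_id (_ * _), ← Matrix.submatrix_mul_equiv _ _ id finSigmaFinEquiv id,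
    Matrix.det_mul, det_confluentVandermonde, ← vandermondeProd] at h
  -- Cancellation fails when two nodes of positive multiplicity coincide; then their columns with `l
  -- = 0` are equal and both sides vanish.
  by_cases h0 : vandermondeProd t z = 0
  · rw [h0, zero_pow two_ne_zero, sq_eq_zero_iff]
    obtain ⟨i, -, hi⟩ := Finset.prod_eq_zero_iff.1 h0
    obtain ⟨j, hj, hij⟩ := Finset.prod_eq_zero_iff.1 hi
    obtain ⟨hz, ht⟩ := pow_eq_zero_iff'.1 hij
    have hz := sub_eq_zero.1 hz
    have htj : 0 < t j := Nat.pos_of_ne_zero (left_ne_zero_of_mul ht)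
    have hti : 0 < t i := Nat.pos_of_ne_zero (right_ne_zero_of_mul ht)
    have hq : nodeQuotient t z ⟨i, ⟨0, hti⟩⟩ = nodeQuotient t z ⟨j, ⟨0, htj⟩⟩ := by
      have h1 := nodeQuotient_mul t z ⟨i, ⟨0, hti⟩⟩
      rw [← nodeQuotient_mul t z ⟨j, ⟨0, htj⟩⟩] at h1
      simp only [hz, zero_add, pow_one] at h1
      refine mul_right_cancel₀ (fun h2 => ?_) h1
      rw [sub_eq_zero] at h2
      exact X_ne_C _ h2.symm
    refine Matrix.det_zero_of_column_eq (i := ⟨i, ⟨0, hti⟩⟩) (j := ⟨j, ⟨0, htj⟩⟩) ?_ ?_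
    · intro h
      exact (Finset.mem_Iio.1 hj).ne' (congrArg Sigma.fst h)
    · intro k
      simp [coeffMatrix, hq]
  · refine mul_left_cancel₀ (pow_ne_zero 2 h0) ?_
    rw [← mul_pow, h]
    ring

/-- The polynomials spanning the numerators of the columns of a confluent Cauchy–Vandermonde
matrix. -/
def cauchyNumerator (t : Fin n → ℕ) (z : Fin n → K) (U : ℕ) : ((Σ j, Fin (t j)) ⊕ Fin U) → K[X] :=
  Sum.elim (nodeQuotient t z) fun l => nodePolynomial t z * X ^ (l : ℕ)

theorem degree_cauchyNumerator_lt (t : Fin n → ℕ) (z : Fin n → K) (U : ℕ)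
    (c : (Σ j, Fin (t j)) ⊕ Fin U) :
    (cauchyNumerator t z U c).degree < (∑ j, t j + U : ℕ) := by
  refine degree_le_natDegree.trans_lt ?_
  rcases c with c | l
  · have := natDegree_nodeQuotient_lt t z c
    simp only [cauchyNumerator, Sum.elim_inl]
    exact_mod_cast by omega
  · simp only [cauchyNumerator, Sum.elim_inr]
    rw [(nodePolynomial_monic t z).natDegree_mul (monic_X_pow _), natDegree_nodePolynomial,
      natDegree_X_pow]
    exact_mod_cast by omega

/-- The quotients have degree below `∑ t j`, while `P X^l` is monic of degree `∑ t j + l`. The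
matrix is block upper triangular with a unitriangular lower right block. -/
theorem det_coeffMatrix_cauchyNumerator_sq (t : Fin n → ℕ) (z : Fin n → K) {U N : ℕ}
    (hN : ∑ j, t j + U = N) :
    ((coeffMatrix N (cauchyNumerator t z U)).submatrix
      (((finSigmaFinEquiv.sumCongr (Equiv.refl _)).trans finSumFinEquiv).trans (finCongr hN))
      id).det ^ 2 = vandermondeProd t z ^ 2 := by
  subst hN
  rw [← Matrix.fromBlocks_toBlocks (Matrix.submatrix _ _ _)]
  have h21 : ((coeffMatrix (∑ j, t j + U) (cauchyNumerator t z U)).submatrix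
      (((finSigmaFinEquiv.sumCongr (Equiv.refl _)).trans finSumFinEquiv).trans (finCongr rfl))
      id).toBlocks₂₁ = 0 := by
    ext l c
    simp only [Matrix.toBlocks₂₁, coeffMatrix, Matrix.of_apply, Matrix.submatrix_apply,
      cauchyNumerator, id, Sum.elim_inl, Matrix.zero_apply]
    refine coeff_eq_zero_of_natDegree_lt ((natDegree_nodeQuotient_lt t z c).trans_le ?_)
    simp
  have h22 : ((coeffMatrix (∑ j, t j + U) (cauchyNumerator t z U)).submatrix
      (((finSigmaFinEquiv.sumCongr (Equiv.refl _)).trans finSumFinEquiv).trans (finCongr rfl))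
      id).toBlocks₂₂.det = 1 := by
    have key : ∀ l : ℕ, (nodePolynomial t z * X ^ l).natDegree = ∑ j, t j + l := fun l => by
      rw [(nodePolynomial_monic t z).natDegree_mul (monic_X_pow _), natDegree_nodePolynomial,
        natDegree_X_pow]
    rw [← Matrix.det_transpose, det_eq_prod_diag_of_injective _ id Function.injective_id]
    · refine Finset.prod_eq_one fun l _ => ?_
      have := (nodePolynomial_monic t z).mul (monic_X_pow (l : ℕ))
      rw [Monic, leadingCoeff, key] at this
      simpa [Matrix.toBlocks₂₂, coeffMatrix, cauchyNumerator] using this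
    · intro r c h
      simp only [Matrix.toBlocks₂₂, coeffMatrix, Matrix.of_apply, Matrix.submatrix_apply,
        cauchyNumerator, id, Sum.elim_inr, Matrix.transpose_apply]
      refine coeff_eq_zero_of_natDegree_lt ?_
      rw [key]
      simpa using h
  rw [h21, Matrix.det_fromBlocks_zero₂₁, h22, mul_one, ← det_coeffMatrix_nodeQuotient_sq]
  congr 2
end

/-! ### The confluent Cauchy–Vandermonde determinant. -/

noncomputable section

variable {K : Type*} [Field K] {m n : ℕ}

/-- The confluent Cauchy–Vandermonde matrix: row `(i, k)` holds the `k`-th Taylor coefficients at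
`v i` of the functions `1 / (z j - X) ^ (l + 1)` and `X ^ l`. -/
def confluentCauchyVandermonde (s : Fin m → ℕ) (t : Fin n → ℕ) (U : ℕ) (v : Fin m → K)
    (z : Fin n → K) : Matrix (Σ i, Fin (s i)) ((Σ j, Fin (t j)) ⊕ Fin U) K :=
  Matrix.of fun r c => match c with
    | Sum.inl jl => ((r.2.1 + jl.2.1).choose jl.2.1 : K) / (z jl.1 - v r.1) ^ (r.2.1 + jl.2.1 + 1)
    | Sum.inr l => v r.1 ^ (l.1 - r.2.1) * (l.1.choose r.2.1 : K)

/-- The block diagonal matrix describing the multiplication by `p` of Taylor expansions at the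
nodes `v i`. -/
def taylorMulMatrix (s : Fin m → ℕ) (v : Fin m → K) (p : K[X]) :
    Matrix (Σ i, Fin (s i)) (Σ i, Fin (s i)) K :=
  Matrix.of fun r c =>
    if r.1 = c.1 ∧ c.2.1 ≤ r.2.1 then (taylor (v r.1) p).coeff (r.2.1 - c.2.1) else 0

theorem det_taylorMulMatrix (s : Fin m → ℕ) (v : Fin m → K) (p : K[X]) :
    (taylorMulMatrix s v p).det = ∏ i, p.eval (v i) ^ s i := by
  rw [det_eq_prod_diag_of_injective _
    (fun r : Σ i, Fin (s i) => toLex (r.1, (r.2 : ℕ)))]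
  · rw [Fintype.prod_sigma]
    simp [taylorMulMatrix, taylor_coeff_zero]
  · rintro ⟨i, k⟩ ⟨j, l⟩ h
    simp only [EmbeddingLike.apply_eq_iff_eq, Prod.mk.injEq] at h
    obtain ⟨rfl, h⟩ := h
    simp [Fin.ext h]
  · rintro ⟨i, k⟩ ⟨j, l⟩ h
    rw [Prod.Lex.toLex_lt_toLex] at h
    simp only at h
    refine if_neg ?_
    rintro ⟨h1, h2⟩
    simp only at h1 h2
    rcases h with h | h
    · exact h.ne h1
    · omega

/-- The `k`-th coefficient of a product of power series uses only coefficients up to `k`, so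
truncating at order `s i` loses nothing. -/
theorem taylorMulMatrix_mul_apply {κ : Type*} (s : Fin m → ℕ) (v : Fin m → K) (p : K[X])
    (G : Matrix (Σ i, Fin (s i)) κ K) (r : Σ i, Fin (s i)) (c : κ) (g : PowerSeries K)
    (hg : ∀ k : Fin (s r.1), G ⟨r.1, k⟩ c = PowerSeries.coeff k g) :
    (taylorMulMatrix s v p * G) r c =
      PowerSeries.coeff r.2 (g * (taylor (v r.1) p : PowerSeries K)) := by
  obtain ⟨i, k⟩ := r
  rw [Matrix.mul_apply, Fintype.sum_sigma, Finset.sum_eq_single i]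
  · simp only [taylorMulMatrix, Matrix.of_apply, true_and, hg]
    rw [PowerSeries.coeff_mul, Finset.Nat.sum_antidiagonal_eq_sum_range_succ
      (fun a b => PowerSeries.coeff a g * PowerSeries.coeff b (taylor (v i) p : PowerSeries K)),
      Fin.sum_univ_eq_sum_range (fun a => (if a ≤ k then (taylor (v i) p).coeff (k - a) else 0) *
        PowerSeries.coeff a g)]
    have hk := k.2
    rw [← Finset.sum_subset (Finset.range_subset_range.2 (Nat.succ_le_of_lt hk))]
    · refine Finset.sum_congr rfl fun a ha => ?_
      rw [if_pos (Nat.lt_succ_iff.1 (Finset.mem_range.1 ha)), Polynomial.coeff_coe, mul_comm]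
    · intro a _ ha
      rw [if_neg (by simpa [Nat.lt_succ_iff] using ha), zero_mul]
  · intro j _ hj
    refine Finset.sum_eq_zero fun l _ => ?_
    rw [taylorMulMatrix, Matrix.of_apply, if_neg (fun h => hj h.1.symm), zero_mul]
  · simp

/-- The expansion of `1 / (a - X) ^ (l + 1)`. -/
theorem mk_choose_div_mul_pow {a : K} (ha : a ≠ 0) (l : ℕ) :
    PowerSeries.mk (fun k => ((k + l).choose l : K) / a ^ (k + l + 1)) *
      ((C a - X : K[X]) : PowerSeries K) ^ (l + 1) = 1 := by
  simp only [Polynomial.coe_sub, Polynomial.coe_C, Polynomial.coe_X]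
  have key : ∀ f : ℕ → K, PowerSeries.mk f * (PowerSeries.C a - PowerSeries.X) =
      PowerSeries.mk fun k => f k * a - if k = 0 then 0 else f (k - 1) := fun f => by
    ext k
    rw [mul_sub, map_sub, PowerSeries.coeff_mul_C, PowerSeries.coeff_mk, PowerSeries.coeff_mk]
    rcases k with _ | k
    · simp
    · simp [PowerSeries.coeff_succ_mul_X]
  induction l with
  | zero =>
    rw [zero_add, pow_one, key]
    ext k
    rcases k with _ | k
    · simp [ha]
    · simp [PowerSeries.coeff_one]
      field_simp
      ring
  | succ l ih =>
    rw [pow_succ', ← mul_assoc, key, ← ih]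
    congr 1
    ext k
    rw [PowerSeries.coeff_mk, PowerSeries.coeff_mk]
    rcases k with _ | k
    · simp
      field_simp
      ring
    -- Pascal's rule: multiplying by one factor `a - X` lowers the pole order by one.
    · have h1 : (k + 1 + (l + 1)).choose (l + 1) =
          (k + 1 + l).choose l + (k + (l + 1)).choose (l + 1) := by
        rw [← add_assoc (k + 1), Nat.choose_succ_succ, add_right_comm, add_assoc k l 1]
      rw [h1, if_neg (Nat.succ_ne_zero k), Nat.add_sub_cancel, Nat.cast_add]
      have h2 : k + 1 + (l + 1) + 1 = (k + (l + 1) + 1) + 1 := by ring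
      have h3 : k + 1 + l + 1 = (k + (l + 1) + 1) := by ring
      rw [h2, h3, pow_succ a (k + (l + 1) + 1)]
      field_simp
      ring

/-- In each row block this is multiplication by `P` of the local expansions, which exist because no
`z j` is a node `v i`. -/
theorem taylorMulMatrix_mul_confluentCauchyVandermonde (s : Fin m → ℕ) (t : Fin n → ℕ) (U : ℕ)
    (v : Fin m → K) (z : Fin n → K) (h : ∀ i j, z j ≠ v i) :
    taylorMulMatrix s v (nodePolynomial t z) * confluentCauchyVandermonde s t U v z =
      taylorMatrix s v (cauchyNumerator t z U) := by
  ext r c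
  rcases c with c | l
  · rw [taylorMulMatrix_mul_apply s v _ _ r _ (PowerSeries.mk fun k =>
      ((k + c.2.1).choose c.2.1 : K) / (z c.1 - v r.1) ^ (k + c.2.1 + 1))
      (fun k => by rw [PowerSeries.coeff_mk]; rfl)]
    have h1 : taylor (v r.1) (nodePolynomial t z) =
        taylor (v r.1) (nodeQuotient t z c) * (C (z c.1 - v r.1) - X) ^ (c.2.1 + 1) := by
      rw [← nodeQuotient_mul t z c, taylor_mul, taylor_pow, map_sub, taylor_C, taylor_X, C_sub]
      congr 2
      ring
    rw [h1, Polynomial.coe_mul, Polynomial.coe_pow, mul_left_comm,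
      mk_choose_div_mul_pow (sub_ne_zero.2 (h r.1 c.1)), mul_one, Polynomial.coeff_coe]
    rfl
  · rw [taylorMulMatrix_mul_apply s v _ _ r _ (taylor (v r.1) (X ^ l.1) : K[X])
      (fun k => by
        rw [Polynomial.coeff_coe, taylor_pow, taylor_X, coeff_X_add_C_pow]; rfl),
      ← Polynomial.coe_mul, Polynomial.coeff_coe, mul_comm, ← taylor_mul]
    rfl

theorem det_confluentCauchyVandermonde_sq (s : Fin m → ℕ) (t : Fin n → ℕ) {U : ℕ}
    (hU : ∑ j, t j + U = ∑ i, s i) (v : Fin m → K) (z : Fin n → K) (h : ∀ i j, z j ≠ v i) :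
    ((confluentCauchyVandermonde s t U v z).submatrix finSigmaFinEquiv.symm
      (((finSigmaFinEquiv.sumCongr (Equiv.refl _)).trans finSumFinEquiv).trans
        (finCongr hU)).symm).det ^ 2 * (∏ i, ∏ j, (v i - z j) ^ (s i * t j)) ^ 2 =
      vandermondeProd s v ^ 2 * vandermondeProd t z ^ 2 := by
  set e := ((finSigmaFinEquiv.sumCongr (Equiv.refl (Fin U))).trans finSumFinEquiv).trans
        (finCongr hU) with he
  have hprod : ∏ i, ∏ j, (v i - z j) ^ (s i * t j) =
      ((taylorMulMatrix s v (nodePolynomial t z)).submatrix finSigmaFinEquiv.symm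
        finSigmaFinEquiv.symm).det := by
    rw [Matrix.det_submatrix_equiv_self, det_taylorMulMatrix]
    simp [nodePolynomial, eval_prod, ← Finset.prod_pow, ← pow_mul, mul_comm]
  rw [hprod, mul_comm, ← mul_pow, ← Matrix.det_mul, Matrix.submatrix_mul_equiv,
    taylorMulMatrix_mul_confluentCauchyVandermonde _ _ _ _ _ h,
    ← confluentVandermonde_mul_coeffMatrix _ _ _
      (fun c => (degree_cauchyNumerator_lt t z U c).trans_le (by rw [hU])),
    ← det_coeffMatrix_cauchyNumerator_sq t z hU, vandermondeProd, ← det_confluentVandermonde,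
    ← mul_pow, ← he]
  rw [← Matrix.submatrix_mul_equiv _ _ _ (Equiv.refl _), Matrix.det_mul]
  congr 2
  · rw [← Matrix.det_submatrix_equiv_self finSigmaFinEquiv]
    congr 1
    ext; simp
  · rw [← Matrix.det_submatrix_equiv_self e]
    congr 1
    ext; simp
end

/-! ### The cube root of unity and the removal of the `2 × 2` blocks. -/

noncomputable section

variable {m n : ℕ}

theorem zetaThree_pow_three : zetaThree ^ 3 = 1 := by
  rw [zetaThree, ← Complex.exp_nat_mul]
  convert Complex.exp_two_pi_mul_I using 2
  push_cast
  ring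

theorem zetaThree_ne_zero : zetaThree ≠ 0 := Complex.exp_ne_zero _

theorem norm_zetaThree : ‖zetaThree‖ = 1 :=
  Complex.norm_eq_one_of_pow_eq_one zetaThree_pow_three three_ne_zero

theorem conj_zetaThree : (starRingEnd ℂ) zetaThree = zetaThree⁻¹ :=
  (Complex.inv_eq_conj norm_zetaThree).symm

theorem zetaThree_sq_add : zetaThree ^ 2 + zetaThree + 1 = 0 := by
  have h : zetaThree ≠ 1 := by
    have := Complex.isPrimitiveRoot_exp 3 three_ne_zero
    have h2 : zetaThree = Complex.exp (2 * Real.pi * Complex.I / (3 : ℕ)) := by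
      rw [zetaThree]; norm_num
    rw [h2]
    exact this.ne_one (by norm_num)
  refine mul_left_cancel₀ (sub_ne_zero.2 h) ?_
  linear_combination zetaThree_pow_three

theorem zetaThree_inv : zetaThree⁻¹ = -1 - zetaThree := by
  refine inv_eq_of_mul_eq_one_right ?_
  linear_combination -zetaThree_sq_add

theorem re_zetaThree : zetaThree.re = -1 / 2 := by
  have h := congrArg Complex.re zetaThree_inv
  rw [← conj_zetaThree] at h
  simp at h
  linarith

/-- This rests on `|ζ| = 1` and `Re ζ = -1/2`, and turns differences of nodes into oblique
distances. -/
theorem norm_sub_zetaThree_mul_sq (u v : ℝ) :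
    ‖(u : ℂ) - zetaThree * v‖ ^ 2 = obliqueNormSq u v := by
  have h1 := norm_zetaThree
  have h : zetaThree.re * zetaThree.re + zetaThree.im * zetaThree.im = 1 := by
    rw [← Complex.normSq_apply, Complex.normSq_eq_norm_sq, h1, one_pow]
  have h2 := re_zetaThree
  rw [← Complex.normSq_eq_norm_sq, Complex.normSq_apply, obliqueNormSq]
  simp only [Complex.sub_re, Complex.sub_im, Complex.ofReal_re, Complex.ofReal_im, Complex.mul_re,
    Complex.mul_im]
  linear_combination v ^ 2 * h - 2 * u * v * h2

theorem obliqueNormSq_eq_zero_iff {u v : ℝ} : obliqueNormSq u v = 0 ↔ u = 0 ∧ v = 0 := by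
  constructor
  · intro h
    rw [obliqueNormSq] at h
    constructor <;> nlinarith [sq_nonneg (u + v), sq_nonneg u, sq_nonneg v]
  · rintro ⟨rfl, rfl⟩
    simp [obliqueNormSq]

theorem obliqueNormSq_neg (u v : ℝ) : obliqueNormSq (-u) (-v) = obliqueNormSq u v := by
  simp only [obliqueNormSq]; ring

/-- The part of an entry of `dominantBlocks` inside the bracket that does not depend on the
position in the `2 × 2` block. -/
def dominantEntry (s : Fin m → ℕ) (t : Fin n → ℕ) (U : ℕ) (R : ℝ)
    (x y : Fin m → ℝ) (z w : Fin n → ℝ)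
    (α β : Fin m → ℤ) (γ δ : Fin n → ℤ) (q : Fin m → ℚ) (q' : Fin n → ℚ) (h : ℂ) :
    Matrix (Σ i, Fin (s i)) ((Σ j, Fin (t j)) ⊕ Fin U) ℂ :=
  Matrix.of fun r c =>
    match c with
    | Sum.inl jl =>
        h ^ (α r.1 - β r.1 + γ jl.1 - δ jl.1) * ((r.2.1 + jl.2.1).choose jl.2.1 : ℂ)
          * (1 - (q r.1 : ℂ) * h) ^ r.2.1 * (1 - (q' jl.1 : ℂ) * h) ^ jl.2.1
        / (((z jl.1 : ℂ) - x r.1 - h * ((w jl.1 : ℂ) - y r.1)) ^ (r.2.1 + jl.2.1 + 1)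
          * (R : ℂ) ^ (r.2.1 + jl.2.1 + 1))
    | Sum.inr l =>
        h ^ (α r.1 - β r.1) * (l.1.choose r.2.1 : ℂ) * (1 - (q r.1 : ℂ) * h) ^ r.2.1
        / (((x r.1 : ℂ) - h * (y r.1 : ℂ)) ^ ((r.2.1 : ℤ) - (l.1 : ℤ))
          * (R : ℂ) ^ ((r.2.1 : ℤ) - (l.1 : ℤ)))

theorem dominantBlocks_apply (s : Fin m → ℕ) (t : Fin n → ℕ) (R : ℝ)
    (x y : Fin m → ℝ) (z w : Fin n → ℝ)
    (α β : Fin m → ℤ) (γ δ : Fin n → ℤ) (q : Fin m → ℚ) (q' : Fin n → ℚ)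
    (r : Σ i, Fin (s i)) (c : (Σ j, Fin (t j)) ⊕ Fin (∑ i, s i - ∑ j, t j)) (u v : Fin 2) :
    dominantBlocks s t R x y z w α β γ δ q q' (r, u) (c, v) =
      1 / (2 * Real.pi * Complex.I) *
        (zetaThree ^ blockShift u v * dominantEntry s t _ R x y z w α β γ δ q q' zetaThree r c
        - zetaThree⁻¹ ^ blockShift u v *
          dominantEntry s t _ R x y z w α β γ δ q q' zetaThree⁻¹ r c) := by
  have h0 := zetaThree_ne_zero
  rcases c with c | l
  · simp only [dominantBlocks, dominantEntry, dotA, zetaBracket, Matrix.of_apply]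
    rw [show blockShift u v + α r.1 - β r.1 + γ c.1 - δ c.1 =
      blockShift u v + (α r.1 - β r.1 + γ c.1 - δ c.1) by ring, zpow_add₀ h0,
      zpow_add₀ (inv_ne_zero h0)]
    ring
  · simp only [dominantBlocks, dominantEntry, dotB, zetaBracket, Matrix.of_apply]
    rw [show blockShift u v + α r.1 - β r.1 =
      blockShift u v + (α r.1 - β r.1) by ring, zpow_add₀ h0, zpow_add₀ (inv_ne_zero h0)]
    ring

/-- The entries of the dominant terms with rows and columns numbered. -/
def dominantEntryMatrix (s : Fin m → ℕ) (t : Fin n → ℕ) (hst : ∑ j, t j ≤ ∑ i, s i) (R : ℝ)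
    (x y : Fin m → ℝ) (z w : Fin n → ℝ)
    (α β : Fin m → ℤ) (γ δ : Fin n → ℤ) (q : Fin m → ℚ) (q' : Fin n → ℚ) (h : ℂ) :
    Matrix (Fin (∑ i, s i)) (Fin (∑ i, s i)) ℂ :=
  (dominantEntry s t _ R x y z w α β γ δ q q' h).submatrix finSigmaFinEquiv.symm
    (((finSigmaFinEquiv.sumCongr (Equiv.refl _)).trans finSumFinEquiv).trans
        (finCongr (Nat.add_sub_of_le hst))).symm

/-- The left factor of the `2 × 2` blocks. -/
def blockLeft : Matrix (Fin 2) (Fin 2) ℂ :=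
  (1 / (2 * Real.pi * Complex.I)) •
    !![zetaThree⁻¹, -zetaThree; zetaThree, -zetaThree⁻¹]

/-- The right factor of the `2 × 2` blocks. -/
def blockRight : Matrix (Fin 2) (Fin 2) ℂ := !![1, zetaThree; 1, zetaThree⁻¹]

-- With `e_uv ≡ a_u + b_v` mod 3, row `u` of `blockLeft` holds `ζ^(a_u)` and `-ζ^(-a_u)` (scaled by
-- `1 / 2πi`), and column `v` of `blockRight` holds `ζ^(b_v)` and `ζ^(-b_v)`.
open scoped Kronecker in
theorem dominantMatrix_eq (s : Fin m → ℕ) (t : Fin n → ℕ) (hst : ∑ j, t j ≤ ∑ i, s i) (R : ℝ)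
    (x y : Fin m → ℝ) (z w : Fin n → ℝ)
    (α β : Fin m → ℤ) (γ δ : Fin n → ℤ) (q : Fin m → ℚ) (q' : Fin n → ℚ) :
    dominantMatrix s t hst R x y z w α β γ δ q q' =
      ((1 ⊗ₖ blockLeft) * Matrix.blockDiagonal
        ![dominantEntryMatrix s t hst R x y z w α β γ δ q q' zetaThree,
          dominantEntryMatrix s t hst R x y z w α β γ δ q q' zetaThree⁻¹] *
        (1 ⊗ₖ blockRight)).submatrix finProdFinEquiv.symm finProdFinEquiv.symm := by
  ext a b
  obtain ⟨⟨a, u⟩, rfl⟩ := finProdFinEquiv.surjective a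
  obtain ⟨⟨b, v⟩, rfl⟩ := finProdFinEquiv.surjective b
  have h1 : dominantMatrix s t hst R x y z w α β γ δ q q' (finProdFinEquiv (a, u))
      (finProdFinEquiv (b, v)) = dominantBlocks s t R x y z w α β γ δ q q'
      (finSigmaFinEquiv.symm a, u) ((((finSigmaFinEquiv.sumCongr (Equiv.refl _)).trans
        finSumFinEquiv).trans (finCongr (Nat.add_sub_of_le hst))).symm b, v) := by
    simp only [dominantMatrix, Matrix.reindex_apply, Matrix.submatrix_apply, rowNumbering,
      colNumbering, Equiv.symm_trans_apply, Equiv.symm_apply_apply, Equiv.prodCongr_symm,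
      Equiv.prodCongr_apply, Prod.map, Equiv.refl_symm, Equiv.refl_apply]
  have h0 := zetaThree_ne_zero
  have hs : zetaThree ^ 2 = zetaThree⁻¹ := by
    refine eq_inv_of_mul_eq_one_left ?_
    rw [← pow_succ, zetaThree_pow_three]
  have hs' : zetaThree⁻¹ ^ 2 = zetaThree := by
    rw [← hs, ← pow_mul, pow_succ, zetaThree_pow_three, one_mul]
  rw [h1, dominantBlocks_apply]
  simp only [Matrix.submatrix_apply, Equiv.symm_apply_apply, Matrix.mul_apply,
    Fintype.sum_prod_type, Matrix.kroneckerMap_apply, Matrix.one_apply, Matrix.blockDiagonal_apply,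
    Fin.sum_univ_two, ite_mul, one_mul, zero_mul, mul_ite, mul_zero, Finset.sum_add_distrib,
    Finset.sum_ite_eq, Finset.sum_ite_eq', Finset.mem_univ, if_true]
  simp only [Matrix.cons_val_zero, Matrix.cons_val_one, dominantEntryMatrix,
    Matrix.submatrix_apply]
  generalize dominantEntry s t _ R x y z w α β γ δ q q' zetaThree _ _ = D
  generalize dominantEntry s t _ R x y z w α β γ δ q q' zetaThree⁻¹ _ _ = D'
  have h4 : zetaThree * zetaThree⁻¹ = 1 := mul_inv_cancel₀ h0
  have h5 := zetaThree_pow_three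
  clear h1
  simp only [blockLeft, blockRight, blockShift]
  fin_cases u <;> fin_cases v <;> simp [h5] <;> generalize zetaThree⁻¹ = ω at *
  · ring
  · linear_combination Complex.I * ((Real.pi : ℂ)⁻¹ * 2⁻¹) * (D - D') * h4
  · ring
  · linear_combination Complex.I * ((Real.pi : ℂ)⁻¹ * 2⁻¹) * (D * hs - D' * hs')

theorem det_dominantMatrix (s : Fin m → ℕ) (t : Fin n → ℕ) (hst : ∑ j, t j ≤ ∑ i, s i) (R : ℝ)
    (x y : Fin m → ℝ) (z w : Fin n → ℝ)
    (α β : Fin m → ℤ) (γ δ : Fin n → ℤ) (q : Fin m → ℚ) (q' : Fin n → ℚ) :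
    (dominantMatrix s t hst R x y z w α β γ δ q q').det =
      (((3 / (4 * Real.pi ^ 2)) ^ (∑ i, s i) *
        ‖(dominantEntryMatrix s t hst R x y z w α β γ δ q q' zetaThree).det‖ ^ 2 : ℝ) : ℂ) := by
  -- All data other than `ζ` are real, so replacing `ζ` by its inverse conjugates every entry.
  have hconj : dominantEntryMatrix s t hst R x y z w α β γ δ q q' zetaThree⁻¹ =
      (starRingEnd ℂ).mapMatrix
        (dominantEntryMatrix s t hst R x y z w α β γ δ q q' zetaThree) := by
    ext a b
    simp only [dominantEntryMatrix, dominantEntry, RingHom.mapMatrix_apply, Matrix.map_apply,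
      Matrix.submatrix_apply, Matrix.of_apply]
    rcases (((finSigmaFinEquiv.sumCongr (Equiv.refl _)).trans finSumFinEquiv).trans
        (finCongr (Nat.add_sub_of_le hst))).symm b with c | l <;>
    simp [conj_zetaThree, map_zpow₀]
  have hlr : (blockLeft * blockRight).det = 3 / (4 * Real.pi ^ 2) := by
    rw [Matrix.det_mul, blockLeft, blockRight, Matrix.det_smul, Matrix.det_fin_two_of,
      Matrix.det_fin_two_of, zetaThree_inv, Fintype.card_fin]
    have := zetaThree_sq_add
    have hp : (Real.pi : ℂ) ≠ 0 := by exact_mod_cast Real.pi_ne_zero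
    -- The two unscaled determinants multiply to `-3`, and `(1 / 2πi)² = -1 / 4π²`; this is the
    -- source of `3 / 4π²`.
    have e : ((-1 - zetaThree) * -(-1 - zetaThree) - -zetaThree * zetaThree) *
        (1 * (-1 - zetaThree) - zetaThree * 1) = -3 := by
      linear_combination 4 * this
    rw [mul_assoc, e, div_pow, mul_pow, Complex.I_sq]
    field_simp
    norm_num
  rw [dominantMatrix_eq, Matrix.det_submatrix_equiv_self, Matrix.det_mul, Matrix.det_mul,
    Matrix.det_kronecker, Matrix.det_kronecker, Matrix.det_one, one_pow, one_mul, one_mul,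
    mul_right_comm, ← mul_pow, ← Matrix.det_mul, Fintype.card_fin, hlr,
    Matrix.det_blockDiagonal, Fin.prod_univ_two, Matrix.cons_val_zero, Matrix.cons_val_one,
    Matrix.cons_val_fin_one, hconj, ← RingHom.map_det, Complex.mul_conj, Complex.normSq_eq_norm_sq]
  push_cast
  rfl

end

/-! ### Moduli of the row and column factors and of the node products. -/

noncomputable section

variable {m n : ℕ}

theorem norm_one_sub_mul_zetaThree_sq (q : ℚ) :
    ‖1 - (q : ℂ) * zetaThree‖ ^ 2 = (q : ℝ) ^ 2 + q + 1 := by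
  have h := norm_sub_zetaThree_mul_sq 1 q
  rw [obliqueNormSq] at h
  push_cast at h
  rw [mul_comm (q : ℂ), h]
  ring

theorem prod_sigma_pow {M : Type*} [CommMonoid M] (s : Fin m → ℕ) (f : Fin m → M) :
    ∏ r : Σ i, Fin (s i), f r.1 ^ r.2.1 = ∏ i, f i ^ (s i).choose 2 := by
  rw [Fintype.prod_sigma]
  refine Finset.prod_congr rfl fun i _ => ?_
  dsimp only
  rw [Finset.prod_pow_eq_pow_sum, Fin.sum_univ_eq_sum_range (fun k => k), Finset.sum_range_id,
    Nat.choose_two_right]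

theorem dominantEntry_eq (s : Fin m → ℕ) (t : Fin n → ℕ) (U : ℕ) (R : ℝ)
    (x y : Fin m → ℝ) (z w : Fin n → ℝ)
    (α β : Fin m → ℤ) (γ δ : Fin n → ℤ) (q : Fin m → ℚ) (q' : Fin n → ℚ) {h : ℂ} (h0 : h ≠ 0)
    (r : Σ i, Fin (s i)) (c : (Σ j, Fin (t j)) ⊕ Fin U) :
    dominantEntry s t U R x y z w α β γ δ q q' h r c =
      (h ^ (α r.1 - β r.1) * (1 - (q r.1 : ℂ) * h) ^ r.2.1) *
      (Sum.elim (fun jl => h ^ (γ jl.1 - δ jl.1) * (1 - (q' jl.1 : ℂ) * h) ^ jl.2.1)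
          (fun _ => 1) c *
        confluentCauchyVandermonde s t U (fun i => R * (x i - h * y i))
          (fun j => R * (z j - h * w j)) r c) := by
  rcases c with c | l
  · simp only [dominantEntry, confluentCauchyVandermonde, Matrix.of_apply, Sum.elim_inl]
    rw [show α r.1 - β r.1 + γ c.1 - δ c.1 = (α r.1 - β r.1) + (γ c.1 - δ c.1) by ring,
      zpow_add₀ h0, ← mul_pow]
    rw [show (R : ℂ) * (z c.1 - h * w c.1) - R * (x r.1 - h * y r.1) =
      (z c.1 - x r.1 - h * (w c.1 - y r.1)) * R by ring]
    ring
  · simp only [dominantEntry, confluentCauchyVandermonde, Matrix.of_apply, Sum.elim_inr]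
    -- For `k ≤ l` the divisor is the inverse of a natural power, so no base has to be nonzero. For
    -- `l < k` the binomial coefficient makes both sides 0, whatever the truncated exponent `l - k`
    -- gives.
    rcases le_or_gt r.2.1 l.1 with hkl | hkl
    · rw [show (r.2.1 : ℤ) - l.1 = -((l.1 - r.2.1 : ℕ) : ℤ) by push_cast [hkl]; ring,
        zpow_neg, zpow_neg, zpow_natCast, zpow_natCast, ← mul_inv, div_inv_eq_mul, ← mul_pow]
      ring
    · rw [Nat.choose_eq_zero_of_lt hkl]
      simp

/-- Row and column scalings factor out of the determinant. The exponents `0, …, s i - 1` of `1 - q i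
ζ` add up to `(s i).choose 2`, and the residues vanish because `|ζ| = 1`. -/
theorem norm_det_dominantEntryMatrix (s : Fin m → ℕ) (t : Fin n → ℕ)
    (hst : ∑ j, t j ≤ ∑ i, s i) (R : ℝ)
    (x y : Fin m → ℝ) (z w : Fin n → ℝ)
    (α β : Fin m → ℤ) (γ δ : Fin n → ℤ) (q : Fin m → ℚ) (q' : Fin n → ℚ) :
    ‖(dominantEntryMatrix s t hst R x y z w α β γ δ q q' zetaThree).det‖ ^ 2 =
      (∏ i, (q i ^ 2 + q i + 1 : ℝ) ^ (s i).choose 2)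
        * (∏ j, (q' j ^ 2 + q' j + 1 : ℝ) ^ (t j).choose 2) *
      ‖((confluentCauchyVandermonde s t (∑ i, s i - ∑ j, t j)
        (fun i => (R : ℂ) * (x i - zetaThree * y i))
        (fun j => (R : ℂ) * (z j - zetaThree * w j))).submatrix finSigmaFinEquiv.symm
        (((finSigmaFinEquiv.sumCongr (Equiv.refl _)).trans finSumFinEquiv).trans
          (finCongr (Nat.add_sub_of_le hst))).symm).det‖ ^ 2 := by
  set G := confluentCauchyVandermonde s t (∑ i, s i - ∑ j, t j)
        (fun i => (R : ℂ) * (x i - zetaThree * y i)) (fun j => (R : ℂ) * (z j - zetaThree * w j))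
  set e := (((finSigmaFinEquiv.sumCongr (Equiv.refl _)).trans finSumFinEquiv).trans
          (finCongr (Nat.add_sub_of_le hst))) with he
  set ρ : (Σ i, Fin (s i)) → ℂ := fun r =>
    zetaThree ^ (α r.1 - β r.1) * (1 - (q r.1 : ℂ) * zetaThree) ^ r.2.1
  set σ : ((Σ j, Fin (t j)) ⊕ Fin (∑ i, s i - ∑ j, t j)) → ℂ :=
    Sum.elim (fun jl => zetaThree ^ (γ jl.1 - δ jl.1) *
      (1 - (q' jl.1 : ℂ) * zetaThree) ^ jl.2.1) (fun _ => 1)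
  have hM : dominantEntryMatrix s t hst R x y z w α β γ δ q q' zetaThree =
      Matrix.of fun a b => ρ (finSigmaFinEquiv.symm a) * (Matrix.of fun a b => σ (e.symm b) *
        G.submatrix finSigmaFinEquiv.symm e.symm a b) a b := by
    ext a b
    exact dominantEntry_eq s t _ R x y z w α β γ δ q q' zetaThree_ne_zero _ _
  have hρ : ‖∏ a, ρ (finSigmaFinEquiv.symm a)‖ ^ 2 =
      ∏ i, (q i ^ 2 + q i + 1 : ℝ) ^ (s i).choose 2 := by
    rw [Equiv.prod_comp finSigmaFinEquiv.symm ρ, norm_prod, ← Finset.prod_pow,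
      ← prod_sigma_pow s (fun i => (q i ^ 2 + q i + 1 : ℝ))]
    refine Finset.prod_congr rfl fun r _ => ?_
    rw [norm_mul, norm_zpow, norm_zetaThree, one_zpow, one_mul, norm_pow, pow_right_comm,
      norm_one_sub_mul_zetaThree_sq]
  have hσ : ‖∏ b, σ (e.symm b)‖ ^ 2 = ∏ j, (q' j ^ 2 + q' j + 1 : ℝ) ^ (t j).choose 2 := by
    rw [Equiv.prod_comp e.symm σ, Fintype.prod_sum_type]
    simp only [σ, Sum.elim_inl, Sum.elim_inr, Finset.prod_const_one, mul_one]
    rw [norm_prod, ← Finset.prod_pow, ← prod_sigma_pow t (fun i => (q' i ^ 2 + q' i + 1 : ℝ))]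
    refine Finset.prod_congr rfl fun r _ => ?_
    rw [norm_mul, norm_zpow, norm_zetaThree, one_zpow, one_mul, norm_pow, pow_right_comm,
      norm_one_sub_mul_zetaThree_sq]
  rw [hM, Matrix.det_mul_column, Matrix.det_mul_row, norm_mul, norm_mul, mul_pow, mul_pow, hρ, hσ]
  ring

theorem norm_vandermondeProd_sq (s : Fin m → ℕ) (R : ℝ) (x y : Fin m → ℝ) :
    ‖vandermondeProd s fun i => (R : ℂ) * (x i - zetaThree * y i)‖ ^ 2 =
      (∏ i, ∏ j ∈ Finset.Ioi i, obliqueNormSq (x i - x j) (y i - y j) ^ (s i * s j)) *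
        R ^ (2 * ∑ i, ∑ j ∈ Finset.Ioi i, s i * s j) := by
  have h : vandermondeProd s (fun i => (R : ℂ) * (x i - zetaThree * y i)) =
      ∏ i, ∏ j ∈ Finset.Ioi i, ((R : ℂ) * (x j - zetaThree * y j) -
        R * (x i - zetaThree * y i)) ^ (s i * s j) :=
    Finset.prod_comm' fun _ _ => by simp
  rw [h, Finset.mul_sum, ← Finset.prod_pow_eq_pow_sum, ← Finset.prod_mul_distrib, norm_prod,
    ← Finset.prod_pow]
  refine Finset.prod_congr rfl fun i _ => ?_
  rw [Finset.mul_sum, ← Finset.prod_pow_eq_pow_sum, ← Finset.prod_mul_distrib, norm_prod,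
    ← Finset.prod_pow]
  refine Finset.prod_congr rfl fun j _ => ?_
  rw [pow_mul R 2, ← mul_pow, norm_pow, pow_right_comm]
  congr 1
  -- The oblique form is even, so the orientation of the difference is irrelevant; `|R|² = R²`
  -- supplies the power of `R`.
  rw [← obliqueNormSq_neg, neg_sub, neg_sub, ← norm_sub_zetaThree_mul_sq, ← sq_abs R,
    ← Real.norm_eq_abs, ← Complex.norm_real, ← mul_pow, ← norm_mul]
  push_cast
  ring_nf

theorem norm_nodeProd_sq (s : Fin m → ℕ) (t : Fin n → ℕ) (R : ℝ)
    (x y : Fin m → ℝ) (z w : Fin n → ℝ) :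
    ‖∏ i, ∏ j, ((R : ℂ) * (x i - zetaThree * y i) - R * (z j - zetaThree * w j)) ^ (s i * t j)‖ ^ 2
      = (∏ i, ∏ j, obliqueNormSq (x i - z j) (y i - w j) ^ (s i * t j)) *
        R ^ (2 * ∑ i, ∑ j, s i * t j) := by
  rw [Finset.mul_sum, ← Finset.prod_pow_eq_pow_sum, ← Finset.prod_mul_distrib, norm_prod,
    ← Finset.prod_pow]
  refine Finset.prod_congr rfl fun i _ => ?_
  rw [Finset.mul_sum, ← Finset.prod_pow_eq_pow_sum, ← Finset.prod_mul_distrib, norm_prod,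
    ← Finset.prod_pow]
  refine Finset.prod_congr rfl fun j _ => ?_
  rw [pow_mul R 2, ← mul_pow, norm_pow, pow_right_comm]
  congr 1
  rw [← norm_sub_zetaThree_mul_sq, ← sq_abs R,
    ← Real.norm_eq_abs, ← Complex.norm_real, ← mul_pow, ← norm_mul]
  push_cast
  ring_nf

end

theorem theorem4p2 {m n : ℕ} (s : Fin m → ℕ) (t : Fin n → ℕ) (hst : ∑ j, t j ≤ ∑ i, s i)
    (q : Fin m → ℚ) (q' : Fin n → ℚ)
    (x y : Fin m → ℝ) (z w : Fin n → ℝ) (hne : ∀ i j, (x i, y i) ≠ (z j, w j))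
    (α β : Fin m → ℤ) (γ δ : Fin n → ℤ) (R : ℝ) (hR : 0 < R) :
    (dominantMatrix s t hst R x y z w α β γ δ q q').det =
      (((∏ i, (q i ^ 2 + q i + 1 : ℝ) ^ (s i).choose 2)
        * (∏ j, (q' j ^ 2 + q' j + 1 : ℝ) ^ (t j).choose 2)
        * (3 / (4 * Real.pi ^ 2)) ^ (∑ i, s i)
        * (∏ i, ∏ j ∈ Finset.Ioi i, obliqueNormSq (x i - x j) (y i - y j) ^ (s i * s j))
        * (∏ i, ∏ j ∈ Finset.Ioi i, obliqueNormSq (z i - z j) (w i - w j) ^ (t i * t j))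
        * (∏ i, ∏ j, obliqueNormSq (x i - z j) (y i - w j) ^ (-((s i : ℤ) * t j)))
        * R ^ scaleExponent s t : ℝ) : ℂ) := by
  have hd : ∀ i j, obliqueNormSq (x i - z j) (y i - w j) ≠ 0 := fun i j h => by
    obtain ⟨h1, h2⟩ := obliqueNormSq_eq_zero_iff.1 h
    exact hne i j (Prod.ext (sub_eq_zero.1 h1) (sub_eq_zero.1 h2))
  have hnode : ∀ i j, (R : ℂ) * (z j - zetaThree * w j) ≠ R * (x i - zetaThree * y i) := by
    intro i j h
    refine hd i j ?_
    have h1 := mul_left_cancel₀ (by exact_mod_cast hR.ne') h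
    rw [← norm_sub_zetaThree_mul_sq, sq_eq_zero_iff, norm_eq_zero]
    push_cast
    linear_combination -h1
  have key := congrArg norm (det_confluentCauchyVandermonde_sq s t (Nat.add_sub_of_le hst)
    (fun i => (R : ℂ) * (x i - zetaThree * y i)) (fun j => (R : ℂ) * (z j - zetaThree * w j)) hnode)
  rw [norm_mul, norm_mul, norm_pow, norm_pow, norm_pow, norm_pow, norm_vandermondeProd_sq,
    norm_vandermondeProd_sq, norm_nodeProd_sq] at key
  have hD : ∏ i, ∏ j, obliqueNormSq (x i - z j) (y i - w j) ^ (s i * t j) ≠ 0 :=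
    Finset.prod_ne_zero_iff.2 fun i _ => Finset.prod_ne_zero_iff.2 fun j _ => pow_ne_zero _ (hd i j)
  have hinv : ∏ i, ∏ j, obliqueNormSq (x i - z j) (y i - w j) ^ (-((s i : ℤ) * t j)) =
      (∏ i, ∏ j, obliqueNormSq (x i - z j) (y i - w j) ^ (s i * t j))⁻¹ := by
    simp only [zpow_neg, Finset.prod_inv_distrib]
    congr 1
  have hexp : R ^ scaleExponent s t = R ^ (2 * ∑ i, ∑ j ∈ Finset.Ioi i, s i * s j) *
      R ^ (2 * ∑ i, ∑ j ∈ Finset.Ioi i, t i * t j) / R ^ (2 * ∑ i, ∑ j, s i * t j) := by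
    rw [scaleExponent, zpow_sub₀ hR.ne', zpow_add₀ hR.ne']
    norm_cast
  rw [det_dominantMatrix, norm_det_dominantEntryMatrix s t hst R, hinv, hexp]
  -- Distinctness of the `(x i, y i)` from the `(z j, w j)`, together with `R > 0`, allows division
  -- by the node product.
  rw [← eq_div_iff (mul_ne_zero hD (pow_ne_zero _ hR.ne'))] at key
  rw [key]
  congr 1
  ring
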